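/- **Setting.** All processes have sample paths in $C[0,1]$, and inequalities between functions are pointwise. Let $E^-[0,1]$ be the set of bounded functions $f:[0,1]\to(-\infty,0]$ with only finitely many discontinuities. A *copula process* is a process $U=(U_t)_{t\in[0,1]}$ such that every $U_t$ is uniformly distributed on $(0,1)$. A *generator process* is a process $Z=(Z_t)_{t\in[0,1]}$ with $0\le Z_t\le q$ for some constant $q$ and $E(Z_t)=1$ for all $t$; put $\|f\|_D=E\bigl(\sup_{t\in[0,1]}|f(t)|Z_t\bigr)$ and $m_D=E\bigl(\sup_{t\in[0,1]}Z_t\bigr)$. A copula process $V$ is a *generalized Pareto copula process* (GPCP) with $D$-norm $\|\cdot\|_D$ if there is $\varepsilon_0>0$ with $$P(V\le 1+f)=1-\|f\|_D\qquad\text{for all } f\in E^-[0,1] \text{ with } \|f\|_\infty\le\varepsilon_0 .$$ A copula process $U$ is in the *$\delta$-neighborhood* of the GPCP $V$ if, for every $f\in E^-[0,1]$, $$P(U\le 1+cf)=P(V\le 1+cf)+O(c^{1+\delta})\qquad\text{as } c\downarrow 0 .$$ For $s<0$ let $S_U(s)=\int_0^1 1_{(s,\infty)}(U_t-1)\,dt$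 be the sojourn time of $U$ above $1+s$. Let $U^{(1)},U^{(2)},\dots$ be independent copies of $U$, let $k\ge2$ be an integer, and for $c>0$ put $$n_j(c)=\sum_{i=1}^n 1_{(0,1]}\bigl(S_{U^{(i)}}(-c/j)\bigr),\quad 1\le j\le k,\qquad T_n(c)=\frac{\sum_{j=1}^k\bigl(j\,n_j(c)-\frac1k\sum_{\ell=1}^k\ell\, n_\ell(c)\bigr)^2}{\frac1k\sum_{\ell=1}^k\ell\, n_\ell(c)},$$ with $T_n(c)=0$ if the denominator vanishes. **Theorem.** Suppose that the copula process $U$ is in the $\delta$-neighborhood of a GPCP $V$ for some $\delta>0$, where the $D$-norm of $V$ has generator constant $m_D$. 1. The remainder term $r(s)$, $s<0$, defined by $P(U\le 1+s)=1-|s|\,(m_D+r(s))$, satisfies $r(s)=O(|s|^\delta)$ as $s\uparrow0$. 2. Let $c_n\to0$, $nc_n\to\infty$ and $nc_n^{1+2\delta}\to0$ as $n\to\infty$. Then, in distribution, $$T_n(c_n)\;\longrightarrow\;\sum_{i=1}^{k-1}\lambda_i\xi_i^2\qquad\text{as } n\to\infty,$$ where $\xi_1,\dots,\xi_{k-1}$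 are independent standard normal random variables and $\lambda_i=\dfrac{1}{4\sin^2\left(\frac ik\frac\pi2\right)}$, $1\le i\le k-1$. -/

import Mathlib

open MeasureTheory ProbabilityTheory Filter Topology Asymptotics

/-- The Borel `σ`-algebra on the space `C[0,1]`, equipped with the sup-norm topology. -/
instance instMeasurableSpacePaths : MeasurableSpace C(unitInterval, ℝ) :=
  borel C(unitInterval, ℝ)

instance instBorelSpacePaths : BorelSpace C(unitInterval, ℝ) :=
  ⟨rfl⟩

/-- The set `E⁻[0,1]` of bounded functions `f : [0,1] → ℝ` that have only finitely many
discontinuities and attain only non-positive values. -/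
def EMinus : Set (unitInterval → ℝ) :=
  {f | (∃ M : ℝ, ∀ t, |f t| ≤ M) ∧ {t | ¬ ContinuousAt f t}.Finite ∧ ∀ t, f t ≤ 0}

/-- A generator process `Z`, with paths in `C[0,1]`: `0 ≤ Z_t ≤ q` for some constant `q`,
and `E(Z_t) = 1` for every `t`. -/
structure IsGenerator {Ω : Type*} [MeasurableSpace Ω] (P : Measure Ω)
    (Z : Ω → C(unitInterval, ℝ)) : Prop where
  measurable : Measurable Z
  bounded : ∃ q : ℝ, ∀ ω t, 0 ≤ Z ω t ∧ Z ω t ≤ q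
  mean_one : ∀ t, ∫ ω, Z ω t ∂P = 1

/-- The `D`-norm `‖f‖_D = E(sup_t |f(t)| Z_t)` generated by the process `Z`. -/
noncomputable def dNorm {Ω : Type*} [MeasurableSpace Ω] (P : Measure Ω)
    (Z : Ω → C(unitInterval, ℝ)) (f : unitInterval → ℝ) : ℝ :=
  ∫ ω, ⨆ t, |f t| * Z ω t ∂P

/-- The generator constant `m_D = E(sup_t Z_t) = ‖1‖_D`. -/
noncomputable def generatorConstant {Ω : Type*} [MeasurableSpace Ω] (P : Measure Ω)
    (Z : Ω → C(unitInterval, ℝ)) : ℝ :=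
  ∫ ω, ⨆ t, Z ω t ∂P

/-- A copula process with paths in `C[0,1]`: each `U_t` is uniformly distributed on `(0,1)`. -/
structure IsCopulaProcess {Ω : Type*} [MeasurableSpace Ω] (P : Measure Ω)
    (U : Ω → C(unitInterval, ℝ)) : Prop where
  measurable : Measurable U
  uniform : ∀ t, pdf.IsUniform (fun ω => U ω t) (Set.Ioo (0 : ℝ) 1) P volume

/-- The functional distribution function `P(U ≤ g) = P(U_t ≤ g(t) for all t)`. -/
noncomputable def pathCdf {Ω : Type*} [MeasurableSpace Ω] (P : Measure Ω)
    (U : Ω → C(unitInterval, ℝ)) (g : unitInterval → ℝ) : ℝ :=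
  P.real {ω | ∀ t, U ω t ≤ g t}

/-- `V` is a generalized Pareto copula process whose `D`-norm is generated by `Z`: for some
`ε₀ > 0`, `P(V ≤ 1 + f) = 1 - ‖f‖_D` for all `f ∈ E⁻[0,1]` with `‖f‖_∞ ≤ ε₀`. -/
structure IsGPCP {Ω Ω' : Type*} [MeasurableSpace Ω] [MeasurableSpace Ω'] (P : Measure Ω)
    (V : Ω → C(unitInterval, ℝ)) (P' : Measure Ω') (Z : Ω' → C(unitInterval, ℝ)) : Prop where
  copulaProcess : IsCopulaProcess P V
  generator : IsGenerator P' Z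
  pareto : ∃ ε₀ : ℝ, 0 < ε₀ ∧ ∀ f ∈ EMinus, (∀ t, |f t| ≤ ε₀) →
    pathCdf P V (fun t => 1 + f t) = 1 - dNorm P' Z f

/-- `P(U ≤ 1 + c f) = P(V ≤ 1 + c f) + O(c^{1+δ})` as `c ↓ 0`, for every `f ∈ E⁻[0,1]`.
For a copula process `U` and a generalized Pareto copula process `V` this says that `U` is in the
`δ`-neighborhood of `V`. -/
def InDeltaNeighborhood {Ω Ω' : Type*} [MeasurableSpace Ω] [MeasurableSpace Ω'] (P : Measure Ω)
    (U : Ω → C(unitInterval, ℝ)) (P' : Measure Ω') (V : Ω' → C(unitInterval, ℝ)) (δ : ℝ) : Prop :=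
  ∀ f ∈ EMinus,
    (fun c : ℝ => pathCdf P U (fun t => 1 + c * f t) - pathCdf P' V (fun t => 1 + c * f t))
      =O[𝓝[>] 0] fun c : ℝ => c ^ (1 + δ)

/-- The remainder `r(s)`, `s < 0`, in the expansion `P(U ≤ 1 + s) = 1 - |s| (m + r(s))`. -/
noncomputable def remainderTerm {Ω : Type*} [MeasurableSpace Ω] (P : Measure Ω)
    (U : Ω → C(unitInterval, ℝ)) (m : ℝ) (s : ℝ) : ℝ :=
  (1 - pathCdf P U (fun _ => 1 + s)) / |s| - m

/-- The sojourn time `S_u(s) = ∫₀¹ 1_{(s,∞)}(u_t - 1) dt` of the path `u` above `1 + s`. -/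
noncomputable def sojournTime (u : C(unitInterval, ℝ)) (s : ℝ) : ℝ :=
  ∫ t : unitInterval, (Set.Ioi s).indicator (fun _ => (1 : ℝ)) (u t - 1)

/-- The number `n_j(c)` of paths among the first `n` paths of the sequence `u` whose sojourn time
above `1 - c / j` is positive. -/
noncomputable def exceedanceCount (u : ℕ → C(unitInterval, ℝ)) (n j : ℕ) (c : ℝ) : ℝ :=
  ∑ i ∈ Finset.range n,
    (Set.Ioc (0 : ℝ) 1).indicator (fun _ => (1 : ℝ)) (sojournTime (u i) (-(c / (j : ℝ))))

/-- The mean `k⁻¹ ∑_{ℓ=1}^k ℓ n_ℓ(c)`. -/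
noncomputable def meanCount (u : ℕ → C(unitInterval, ℝ)) (k n : ℕ) (c : ℝ) : ℝ :=
  1 / (k : ℝ) * ∑ l ∈ Finset.Icc 1 k, (l : ℝ) * exceedanceCount u n l c

/-- The test statistic `T_n(c)` computed from the first `n` paths of the sequence `u`. -/
noncomputable def testStatistic (u : ℕ → C(unitInterval, ℝ)) (k n : ℕ) (c : ℝ) : ℝ :=
  (∑ j ∈ Finset.Icc 1 k, ((j : ℝ) * exceedanceCount u n j c - meanCount u k n c) ^ 2)
    / meanCount u k n c

/-- The weight `λ_i = 1 / (4 sin² (i π / (2 k)))`. -/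
noncomputable def limitWeight (k i : ℕ) : ℝ :=
  1 / (4 * Real.sin ((i : ℝ) / (k : ℝ) * (Real.pi / 2)) ^ 2)

/-! For a continuous path, positive sojourn time above a level just means that the level is exceeded
somewhere. So everything depends only on `P(U ≤ 1 - c)`, which equals `1 - c m_D + O(c^(1+δ))`:
apply the neighborhood condition to `f = -1` (`one_sub_pathCdf_const_isBigO`). Part 1 is this
expansion divided by `|s|`.

For part 2, let `Y_j` be `j` times the indicator of an exceedance of `1 - c/j`. Its mean is `c m_D`
up to `O(c^(1+δ))`, the same for every `j`. Since the events are nested, `Y_j Y_l = min(j,l)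
Y_(max(j,l))`, so on the scale `d = n c m_D` the limiting covariance kernel is `min(j,l)`. The
numerator of the statistic is the squared length of the projection orthogonal to constants, which
the discrete cosine basis writes as `k - 1` squared coordinates (`sum_sq_sub_mean_eq`). The same
basis diagonalizes the compression of `min(j,l)` to that subspace, with eigenvalues `λ_i`
(`sum_cosVec_mul_min`).

Orthogonality to constants cancels the common mean, and `n c^(1+2δ) → 0` removes the remaining bias.
A central limit theorem for bounded rows (`tendstoInDistribution_rowSum`) handles the coordinates,
Chebyshev's inequality the denominator (`tendstoInMeasure_rowSum`), and Slutsky's theorem joins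
them. -/

/-! ### Trigonometric sums and orthogonality -/

theorem two_mul_sin_half_mul_sum_cos_add_half (α : ℝ) (p : ℕ) :
    2 * Real.sin (α / 2) * ∑ j ∈ Finset.range p, Real.cos (((j : ℝ) + 1 / 2) * α)
      = Real.sin (p * α) := by
  induction p with
  | zero => simp
  | succ p ih =>
    rw [Finset.sum_range_succ, mul_add, ih]
    have h1 : ((p + 1 : ℕ) : ℝ) * α = ((p : ℝ) + 1 / 2) * α + α / 2 := by push_cast; ring
    have h2 : (p : ℝ) * α = ((p : ℝ) + 1 / 2) * α - α / 2 := by ring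
    rw [h1, h2, Real.sin_add, Real.sin_sub]
    ring

theorem two_mul_sin_half_mul_sum_cos (β : ℝ) (p : ℕ) :
    2 * Real.sin (β / 2) * ∑ j ∈ Finset.range p, Real.cos ((j : ℝ) * β)
      = Real.sin (p * β - β / 2) + Real.sin (β / 2) := by
  induction p with
  | zero => simp
  | succ p ih =>
    rw [Finset.sum_range_succ, mul_add, ih]
    have h1 : ((p + 1 : ℕ) : ℝ) * β - β / 2 = (p : ℝ) * β + β / 2 := by push_cast; ring
    rw [h1, Real.sin_add, Real.sin_sub]
    ring

/-- Allows division in the closed forms above. The range up to `2 * k` is needed because products of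
two frequencies below `k` produce their sum. -/
theorem sin_pi_fraction_ne_zero {k q : ℕ} (h0 : 0 < q) (h1 : q < 2 * k) :
    Real.sin ((q : ℝ) * Real.pi / k / 2) ≠ 0 := by
  have hk : (0 : ℝ) < k := by
    have : 0 < k := by omega
    exact_mod_cast this
  have hq : (0 : ℝ) < q := by exact_mod_cast h0
  have hq1 : (q : ℝ) < 2 * k := by exact_mod_cast h1
  refine (Real.sin_pos_of_pos_of_lt_pi (by positivity) ?_).ne'
  rw [div_div, div_lt_iff₀ (by positivity)]
  nlinarith [Real.pi_pos]

theorem sum_cos_add_half_eq_zero {k q : ℕ} (h0 : 0 < q) (h1 : q < 2 * k) :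
    ∑ j ∈ Finset.range k, Real.cos (((j : ℝ) + 1 / 2) * (q * Real.pi / k)) = 0 := by
  have hk : (k : ℝ) ≠ 0 := by
    have : k ≠ 0 := by omega
    exact_mod_cast this
  have h := two_mul_sin_half_mul_sum_cos_add_half ((q : ℝ) * Real.pi / k) k
  have h2 : (k : ℝ) * (q * Real.pi / k) = q * Real.pi := by field_simp
  rw [h2, Real.sin_nat_mul_pi] at h
  have := sin_pi_fraction_ne_zero h0 h1
  simpa [this] using h

theorem sum_cos_pi_fraction {k q : ℕ} (h0 : 0 < q) (h1 : q < 2 * k) :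
    ∑ j ∈ Finset.range k, Real.cos ((j : ℝ) * (q * Real.pi / k)) = (1 - (-1) ^ q) / 2 := by
  have hk : (k : ℝ) ≠ 0 := by
    have : k ≠ 0 := by omega
    exact_mod_cast this
  have h := two_mul_sin_half_mul_sum_cos ((q : ℝ) * Real.pi / k) k
  have h2 : (k : ℝ) * (q * Real.pi / k) = q * Real.pi := by field_simp
  rw [h2, Real.sin_nat_mul_pi_sub] at h
  have := sin_pi_fraction_ne_zero h0 h1
  apply mul_left_cancel₀ (mul_ne_zero two_ne_zero this)
  rw [h]
  ring

theorem sum_cos_mul_cos_of_lt {k i l : ℕ} (hil : l < i) (hi : i < k) :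
    ∑ j ∈ Finset.range k, Real.cos (((j : ℝ) + 1 / 2) * (i * Real.pi / k))
      * Real.cos (((j : ℝ) + 1 / 2) * (l * Real.pi / k)) = 0 := by
  have e (j : ℕ) : Real.cos (((j : ℝ) + 1 / 2) * (i * Real.pi / k))
      * Real.cos (((j : ℝ) + 1 / 2) * (l * Real.pi / k))
      = (Real.cos (((j : ℝ) + 1 / 2) * ((i - l : ℕ) * Real.pi / k))
        + Real.cos (((j : ℝ) + 1 / 2) * ((i + l : ℕ) * Real.pi / k))) / 2 := by
    have h1 : ((j : ℝ) + 1 / 2) * ((i - l : ℕ) * Real.pi / k)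
      = ((j : ℝ) + 1 / 2) * (i * Real.pi / k) - ((j : ℝ) + 1 / 2) * (l * Real.pi / k) := by
      rw [Nat.cast_sub hil.le]; ring
    have h2 : ((j : ℝ) + 1 / 2) * ((i + l : ℕ) * Real.pi / k)
      = ((j : ℝ) + 1 / 2) * (i * Real.pi / k) + ((j : ℝ) + 1 / 2) * (l * Real.pi / k) := by
      push_cast; ring
    rw [h1, h2, Real.cos_add, Real.cos_sub]; ring
  simp_rw [e, ← Finset.sum_div, Finset.sum_add_distrib]
  rw [sum_cos_add_half_eq_zero (by omega) (by omega),
    sum_cos_add_half_eq_zero (by omega) (by omega)]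
  simp

theorem sum_cos_sq {k i : ℕ} (h0 : 0 < i) (hi : i < k) :
    ∑ j ∈ Finset.range k, Real.cos (((j : ℝ) + 1 / 2) * (i * Real.pi / k)) ^ 2 = k / 2 := by
  have e (j : ℕ) : Real.cos (((j : ℝ) + 1 / 2) * (i * Real.pi / k)) ^ 2
      = (1 + Real.cos (((j : ℝ) + 1 / 2) * ((2 * i : ℕ) * Real.pi / k))) / 2 := by
    have h2 : ((j : ℝ) + 1 / 2) * ((2 * i : ℕ) * Real.pi / k)
      = 2 * (((j : ℝ) + 1 / 2) * (i * Real.pi / k)) := by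
      push_cast; ring
    rw [h2, Real.cos_two_mul]; ring
  simp_rw [e, ← Finset.sum_div, Finset.sum_add_distrib]
  rw [sum_cos_add_half_eq_zero (by omega) (by omega)]
  simp

theorem sum_sin_mul_sin_of_lt {k i l : ℕ} (h0 : 0 < l) (hil : l < i) (hi : i < k) :
    ∑ j ∈ Finset.range k, Real.sin ((j : ℝ) * (i * Real.pi / k))
      * Real.sin ((j : ℝ) * (l * Real.pi / k)) = 0 := by
  have e (j : ℕ) : Real.sin ((j : ℝ) * (i * Real.pi / k))
      * Real.sin ((j : ℝ) * (l * Real.pi / k))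
      = (Real.cos ((j : ℝ) * ((i - l : ℕ) * Real.pi / k))
        - Real.cos ((j : ℝ) * ((i + l : ℕ) * Real.pi / k))) / 2 := by
    have h1 : (j : ℝ) * ((i - l : ℕ) * Real.pi / k)
      = (j : ℝ) * (i * Real.pi / k) - (j : ℝ) * (l * Real.pi / k) := by
      rw [Nat.cast_sub hil.le]; ring
    have h2 : (j : ℝ) * ((i + l : ℕ) * Real.pi / k)
      = (j : ℝ) * (i * Real.pi / k) + (j : ℝ) * (l * Real.pi / k) := by
      push_cast; ring
    rw [h1, h2, Real.cos_add, Real.cos_sub]; ring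
  simp_rw [e, ← Finset.sum_div, Finset.sum_sub_distrib]
  rw [sum_cos_pi_fraction (by omega) (by omega), sum_cos_pi_fraction (by omega) (by omega)]
  -- The two cosine sums depend only on the parity of the frequency, and `i - l` and `i + l` have
  -- the same parity.
  have : i + l = (i - l) + 2 * l := by omega
  rw [this, pow_add, pow_mul]
  simp

theorem sum_sin_sq {k i : ℕ} (h0 : 0 < i) (hi : i < k) :
    ∑ j ∈ Finset.range k, Real.sin ((j : ℝ) * (i * Real.pi / k)) ^ 2 = k / 2 := by
  have e (j : ℕ) : Real.sin ((j : ℝ) * (i * Real.pi / k)) ^ 2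
      = (1 - Real.cos ((j : ℝ) * ((2 * i : ℕ) * Real.pi / k))) / 2 := by
    have h2 : (j : ℝ) * ((2 * i : ℕ) * Real.pi / k) = 2 * ((j : ℝ) * (i * Real.pi / k)) := by
      push_cast; ring
    rw [h2, Real.cos_two_mul, Real.sin_sq]; ring
  simp_rw [e, ← Finset.sum_div, Finset.sum_sub_distrib]
  rw [sum_cos_pi_fraction (by omega) (by omega), pow_mul]
  simp

/-! ### The discrete cosine basis and the kernel `min` -/

/-- The `i`-th vector of the discrete cosine basis of `ℝᵏ`, `0 < i < k`. -/
noncomputable def cosVec (k i j : ℕ) : ℝ :=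
  √(2 / k) * Real.cos (((j : ℝ) + 1 / 2) * (i * Real.pi / k))

theorem sum_cosVec {k i : ℕ} (h0 : 0 < i) (hi : i < k) :
    ∑ j ∈ Finset.range k, cosVec k i j = 0 := by
  simp_rw [cosVec, ← Finset.mul_sum]
  rw [sum_cos_add_half_eq_zero h0 (by omega), mul_zero]

theorem sum_cosVec_mul_cosVec {k i l : ℕ} (h0 : 0 < i) (hi : i < k) (h0' : 0 < l) (hl : l < k) :
    ∑ j ∈ Finset.range k, cosVec k i j * cosVec k l j = if i = l then 1 else 0 := by
  have hk : (0 : ℝ) < k := by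
    have : 0 < k := by omega
    exact_mod_cast this
  have hs : √(2 / (k : ℝ)) * √(2 / (k : ℝ)) = 2 / k := Real.mul_self_sqrt (by positivity)
  have e (j : ℕ) : cosVec k i j * cosVec k l j = 2 / k * (Real.cos (((j : ℝ) + 1 / 2) *
      (i * Real.pi / k)) * Real.cos (((j : ℝ) + 1 / 2) * (l * Real.pi / k))) := by
    rw [← hs, cosVec, cosVec]; ring
  simp_rw [e, ← Finset.mul_sum]
  rcases lt_trichotomy i l with h | h | h
  · rw [if_neg h.ne]
    simp_rw [mul_comm (Real.cos (_ * (i * Real.pi / k)))]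
    rw [sum_cos_mul_cos_of_lt h hl, mul_zero]
  · subst h
    simp_rw [← sq]
    rw [sum_cos_sq h0 hi]
    simp only [if_true]
    field_simp
  · rw [if_neg h.ne', sum_cos_mul_cos_of_lt h hi, mul_zero]

/-- Adjoining the constant unit vector to the cosine vectors gives an orthogonal matrix. By
Parseval, dropping the constant coordinate leaves the squared deviation from the mean. -/
theorem sum_sq_sub_mean_eq (k : ℕ) (x : ℕ → ℝ) :
    ∑ j ∈ Finset.range (k + 1),
        (x j - 1 / ((k + 1 : ℕ) : ℝ) * ∑ l ∈ Finset.range (k + 1), x l) ^ 2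
      = ∑ i : Fin k, (∑ j ∈ Finset.range (k + 1), cosVec (k + 1) (i + 1) j * x j) ^ 2 := by
  set K : ℝ := ((k + 1 : ℕ) : ℝ) with hK
  have hKpos : 0 < K := by rw [hK]; positivity
  let W : Matrix (Fin (k + 1)) (Fin (k + 1)) ℝ :=
    Matrix.of (Fin.cons (fun _ => 1 / √K) fun (i : Fin k) j => cosVec (k + 1) (i + 1) j)
  have hW0 (j) : W 0 j = 1 / √K := rfl
  have hWs (i : Fin k) (j) : W i.succ j = cosVec (k + 1) (i + 1) j := rfl
  have hsq : √K * √K = K := Real.mul_self_sqrt hKpos.le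
  have hWW : W * W.transpose = 1 := by
    ext i l
    rw [Matrix.mul_apply]
    simp only [Matrix.transpose_apply]
    refine Fin.cases ?_ (fun i => ?_) i <;> refine Fin.cases ?_ (fun l => ?_) l
    · simp only [hW0]
      simp [← mul_inv, hsq, ← hK]
    · simp only [hW0, hWs, ← Finset.mul_sum]
      rw [Fin.sum_univ_eq_sum_range (fun j => cosVec (k + 1) (l + 1) j),
        sum_cosVec (by omega) (by omega), Matrix.one_apply_ne (Fin.succ_ne_zero l).symm, mul_zero]
    · simp only [hW0, hWs, ← Finset.sum_mul]
      rw [Fin.sum_univ_eq_sum_range (fun j => cosVec (k + 1) (i + 1) j),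
        sum_cosVec (by omega) (by omega), Matrix.one_apply_ne (Fin.succ_ne_zero i), zero_mul]
    · simp only [hWs]
      rw [Fin.sum_univ_eq_sum_range (fun j => cosVec (k + 1) (i + 1) j * cosVec (k + 1) (l + 1) j),
        sum_cosVec_mul_cosVec (by omega) (by omega) (by omega) (by omega), Matrix.one_apply]
      simp [Fin.ext_iff]
  -- Orthonormality was checked on rows; preserving lengths requires it on columns.
  have hWW' : W.transpose * W = 1 := mul_eq_one_comm.mp hWW
  let y : Fin (k + 1) → ℝ := fun j => x j
  have hpars : W.mulVec y ⬝ᵥ W.mulVec y = y ⬝ᵥ y := by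
    rw [Matrix.dotProduct_mulVec, Matrix.vecMul_mulVec, ← Matrix.dotProduct_mulVec, hWW',
      Matrix.one_mulVec]
  simp only [dotProduct, Matrix.mulVec, y] at hpars
  rw [Fin.sum_univ_succ] at hpars
  simp only [hW0, hWs, ← Finset.mul_sum] at hpars
  rw [Fin.sum_univ_eq_sum_range (fun j => x j), Fin.sum_univ_eq_sum_range (fun j => x j * x j)]
    at hpars
  have hi (i : Fin k) := Fin.sum_univ_eq_sum_range
    (fun j => cosVec (k + 1) (i + 1) j * x j) (k + 1)
  simp_rw [hi, ← sq] at hpars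
  set s := ∑ l ∈ Finset.range (k + 1), x l
  have hs : (1 / √K * s) ^ 2 = s ^ 2 / K := by
    rw [mul_pow, div_pow, sq √K, hsq]; ring
  rw [hs] at hpars
  have : ∑ j ∈ Finset.range (k + 1), (x j - 1 / K * s) ^ 2
      = ∑ j ∈ Finset.range (k + 1), x j ^ 2 - s ^ 2 / K := by
    have e (j : ℕ) : (x j - 1 / K * s) ^ 2 = x j ^ 2 - 2 / K * s * x j + s ^ 2 / K ^ 2 := by
      field_simp; ring
    simp_rw [e, Finset.sum_add_distrib, Finset.sum_sub_distrib, ← Finset.mul_sum]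
    simp only [Finset.sum_const, Finset.card_range, nsmul_eq_mul, ← hK]
    change _ - 2 / K * s * s + _ = _
    field_simp
    ring
  rw [this]
  linarith

/-- The kernel counts the `p` with `p ≤ j` and `p ≤ l`, so the form is a sum of squared tail sums;
each tail is minus a partial sum because the total vanishes. -/
theorem sum_mul_min_eq_sum_sq_partialSum (k : ℕ) (b : ℕ → ℝ) (hb : ∑ j ∈ Finset.range k, b j = 0) :
    ∑ j ∈ Finset.range k, ∑ l ∈ Finset.range k, b j * b l * ((min j l + 1 : ℕ) : ℝ)
      = ∑ p ∈ Finset.range k, (∑ j ∈ Finset.range p, b j) ^ 2 := by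
  have h1 (p : ℕ) (hp : p ∈ Finset.range k) : (∑ j ∈ Finset.range p, b j) ^ 2
      = ∑ j ∈ Finset.range k, ∑ l ∈ Finset.range k, b j * b l * (if p ≤ min j l then 1 else 0) := by
    have h2 : ∑ j ∈ Finset.range p, b j + ∑ j ∈ Finset.Ico p k, b j = 0 := by
      rw [Finset.sum_range_add_sum_Ico _ (Finset.mem_range.mp hp).le, hb]
    have h3 : ∑ j ∈ Finset.Ico p k, b j = ∑ j ∈ Finset.range k, b j * if p ≤ j then 1 else 0 := by
      simp only [mul_ite, mul_one, mul_zero]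
      rw [← Finset.sum_filter]
      congr 1
      ext j
      simp [and_comm]
    rw [eq_neg_of_add_eq_zero_left h2, neg_sq, h3, sq, Finset.sum_mul_sum]
    refine Finset.sum_congr rfl fun j _ => Finset.sum_congr rfl fun l _ => ?_
    by_cases hj : p ≤ j <;> by_cases hl : p ≤ l <;> simp [hj, hl]
  rw [Finset.sum_congr rfl h1]
  conv_rhs => rw [Finset.sum_comm]
  refine Finset.sum_congr rfl fun j hj => ?_
  conv_rhs => rw [Finset.sum_comm]
  refine Finset.sum_congr rfl fun l hl => ?_
  rw [← Finset.mul_sum]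
  congr 1
  rw [Finset.sum_boole]
  congr 1
  rw [Finset.mem_range] at hj hl
  have : Finset.filter (fun p => p ≤ min j l) (Finset.range k) = Finset.range (min j l + 1) := by
    ext p
    simp only [Finset.mem_filter, Finset.mem_range]
    omega
  rw [this, Finset.card_range]

theorem limitWeight_eq {k i : ℕ} :
    limitWeight k i = (1 / (2 * Real.sin ((i : ℝ) * Real.pi / k / 2))) ^ 2 := by
  rw [limitWeight]
  have : (i : ℝ) / k * (Real.pi / 2) = (i : ℝ) * Real.pi / k / 2 := by ring
  rw [this]
  ring

theorem sum_range_cosVec {k i : ℕ} (h0 : 0 < i) (hi : i < k) (p : ℕ) :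
    ∑ j ∈ Finset.range p, cosVec k i j
      = √(2 / k) * (1 / (2 * Real.sin ((i : ℝ) * Real.pi / k / 2)))
        * Real.sin (p * (i * Real.pi / k)) := by
  have h := sin_pi_fraction_ne_zero (k := k) h0 (by omega)
  simp_rw [cosVec, ← Finset.mul_sum]
  rw [← two_mul_sin_half_mul_sum_cos_add_half]
  set S := ∑ j ∈ Finset.range p, Real.cos (((j : ℝ) + 1 / 2) * ((i : ℝ) * Real.pi / k))
  set r := Real.sin ((i : ℝ) * Real.pi / k / 2)
  field_simp

/-- Partial sums of cosine vectors are multiples of sine vectors, which are again orthogonal; their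
squared norms are the weights. Hence the limiting covariance is diagonal. -/
theorem sum_cosVec_mul_min (k : ℕ) (t : Fin k → ℝ) :
    ∑ j ∈ Finset.range (k + 1), ∑ l ∈ Finset.range (k + 1),
        (∑ i : Fin k, t i * cosVec (k + 1) (i + 1) j)
          * (∑ i : Fin k, t i * cosVec (k + 1) (i + 1) l) * ((min j l + 1 : ℕ) : ℝ)
      = ∑ i : Fin k, limitWeight (k + 1) (i + 1) * t i ^ 2 := by
  rw [sum_mul_min_eq_sum_sq_partialSum]
  swap
  · rw [Finset.sum_comm]
    refine Finset.sum_eq_zero fun i _ => ?_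
    rw [← Finset.mul_sum, sum_cosVec (by omega) (by omega), mul_zero]
  have h1 (p : ℕ) : ∑ j ∈ Finset.range p, ∑ i : Fin k, t i * cosVec (k + 1) (i + 1) j
      = ∑ i : Fin k, t i * ∑ j ∈ Finset.range p, cosVec (k + 1) (i + 1) j := by
    rw [Finset.sum_comm]
    simp_rw [Finset.mul_sum]
  have h2 (i l : Fin k) : ∑ p ∈ Finset.range (k + 1),
      (∑ j ∈ Finset.range p, cosVec (k + 1) (i + 1) j)
        * (∑ j ∈ Finset.range p, cosVec (k + 1) (l + 1) j)
      = if i = l then limitWeight (k + 1) (i + 1) else 0 := by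
    have hs : √(2 / ((k + 1 : ℕ) : ℝ)) * √(2 / ((k + 1 : ℕ) : ℝ)) = 2 / ((k + 1 : ℕ) : ℝ) :=
      Real.mul_self_sqrt (by positivity)
    have hi := sum_range_cosVec (k := k + 1) (i := i + 1) (by omega) (by omega)
    have hl := sum_range_cosVec (k := k + 1) (i := l + 1) (by omega) (by omega)
    simp_rw [hi, hl]
    set A := 1 / (2 * Real.sin (((i + 1 : ℕ) : ℝ) * Real.pi / (k + 1 : ℕ) / 2)) with hA
    set B := 1 / (2 * Real.sin (((l + 1 : ℕ) : ℝ) * Real.pi / (k + 1 : ℕ) / 2)) with hB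
    have e (p : ℕ) : √(2 / ((k + 1 : ℕ) : ℝ)) * A
          * Real.sin (p * (((i + 1 : ℕ) : ℝ) * Real.pi / (k + 1 : ℕ)))
        * (√(2 / ((k + 1 : ℕ) : ℝ)) * B
          * Real.sin (p * (((l + 1 : ℕ) : ℝ) * Real.pi / (k + 1 : ℕ))))
        = 2 / ((k + 1 : ℕ) : ℝ) * (A * B) *
          (Real.sin (p * (((i + 1 : ℕ) : ℝ) * Real.pi / (k + 1 : ℕ)))
            * Real.sin (p * (((l + 1 : ℕ) : ℝ) * Real.pi / (k + 1 : ℕ)))) := by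
      linear_combination A * B * Real.sin (p * (((i + 1 : ℕ) : ℝ) * Real.pi / (k + 1 : ℕ)))
        * Real.sin (p * (((l + 1 : ℕ) : ℝ) * Real.pi / (k + 1 : ℕ))) * hs
    simp_rw [e, ← Finset.mul_sum]
    rcases lt_trichotomy i l with h | h | h
    · rw [if_neg h.ne]
      simp_rw [mul_comm (Real.sin (_ * ((i + 1 : ℕ) * Real.pi / _)))]
      rw [sum_sin_mul_sin_of_lt (by omega) (by simpa using h) (by omega), mul_zero]
    · subst h
      rw [if_pos rfl, limitWeight_eq, ← hA]
      simp_rw [← sq]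
      rw [sum_sin_sq (by omega) (by omega)]
      have : ((k + 1 : ℕ) : ℝ) ≠ 0 := by positivity
      field_simp
      exact (sq A).symm
    · rw [if_neg h.ne', sum_sin_mul_sin_of_lt (by omega) (by simpa using h) (by omega), mul_zero]
  simp_rw [h1, sq, Finset.sum_mul_sum]
  rw [Finset.sum_comm]
  refine Finset.sum_congr rfl fun i _ => ?_
  rw [Finset.sum_comm]
  have h3 (l : Fin k) : ∑ p ∈ Finset.range (k + 1),
      (t i * ∑ j ∈ Finset.range p, cosVec (k + 1) (i + 1) j)
        * (t l * ∑ j ∈ Finset.range p, cosVec (k + 1) (l + 1) j)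
      = t i * t l * if i = l then limitWeight (k + 1) (i + 1) else 0 := by
    rw [← h2, Finset.mul_sum]
    exact Finset.sum_congr rfl fun p _ => by ring
  simp_rw [h3]
  simp [mul_comm]

/-! ### Limit theorems for row sums -/

theorem norm_cexp_mul_I_sub_quadratic_le {y : ℝ} (hy : |y| ≤ 1) :
    ‖Complex.exp (y * Complex.I) - (1 + y * Complex.I - (y : ℂ) ^ 2 / 2)‖ ≤ |y| ^ 3 := by
  have hn : ‖(y * Complex.I : ℂ)‖ = |y| := by simp
  have h := Complex.exp_bound (x := y * Complex.I) (by rwa [hn]) (n := 3) (by norm_num)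
  rw [hn] at h
  have e : ∑ m ∈ Finset.range 3, (y * Complex.I : ℂ) ^ m / m.factorial
      = 1 + y * Complex.I - (y : ℂ) ^ 2 / 2 := by
    simp [Finset.sum_range_succ, mul_pow, Nat.factorial]
    ring
  rw [e] at h
  refine h.trans (mul_le_of_le_one_right (by positivity) ?_)
  norm_num [Nat.factorial]

/-- The cubic Taylor error is at most `b * Y ^ 2`, so that after multiplication by `n` a bounded
second moment and `b → 0` suffice. -/
theorem norm_integral_cexp_sub_quadratic_le {Ω : Type*} [MeasurableSpace Ω] {P : Measure Ω}
    [IsProbabilityMeasure P] {Y : Ω → ℝ} (hY : AEStronglyMeasurable Y P) {b : ℝ} (hb1 : b ≤ 1)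
    (hYb : ∀ ω, |Y ω| ≤ b) :
    ‖∫ ω, Complex.exp (Y ω * Complex.I) ∂P
        - (1 + (∫ ω, Y ω ∂P : ℝ) * Complex.I - (∫ ω, Y ω ^ 2 ∂P : ℝ) / 2)‖
      ≤ b * ∫ ω, Y ω ^ 2 ∂P := by
  have hi : Integrable Y P := Integrable.of_bound hY b (ae_of_all _ hYb)
  have hi2 : Integrable (fun ω => Y ω ^ 2) P :=
    Integrable.of_bound (hY.pow 2) (b ^ 2) (ae_of_all _ fun ω => by
      rw [norm_pow]; exact pow_le_pow_left₀ (norm_nonneg _) (hYb ω) 2)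
  have hie : Integrable (fun ω => Complex.exp (Y ω * Complex.I)) P :=
    Integrable.of_bound (by fun_prop) 1 (ae_of_all _ fun ω => by simp)
  have hiC : Integrable (fun ω => (Y ω : ℂ) * Complex.I) P := hi.ofReal.mul_const _
  have hi2C : Integrable (fun ω => (Y ω : ℂ) ^ 2 / 2) P := by
    have := (hi2.ofReal (𝕜 := ℂ)).div_const 2
    simpa using this
  have hiA : Integrable (fun ω => 1 + (Y ω : ℂ) * Complex.I) P := (integrable_const _).add hiC
  have hiS : Integrable (fun ω => 1 + (Y ω : ℂ) * Complex.I - (Y ω : ℂ) ^ 2 / 2) P := hiA.sub hi2C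
  have e : (1 + (∫ ω, Y ω ∂P : ℝ) * Complex.I - (∫ ω, Y ω ^ 2 ∂P : ℝ) / 2 : ℂ)
      = ∫ ω, (1 + Y ω * Complex.I - (Y ω : ℂ) ^ 2 / 2) ∂P := by
    rw [integral_sub hiA hi2C, integral_add (integrable_const _) hiC,
      integral_mul_const, integral_div, ← integral_complex_ofReal, ← integral_complex_ofReal]
    simp
  rw [e, ← integral_sub hie hiS, ← integral_const_mul]
  refine norm_integral_le_of_norm_le (hi2.const_mul b) (ae_of_all _ fun ω => ?_)
  refine (norm_cexp_mul_I_sub_quadratic_le ((hYb ω).trans hb1)).trans ?_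
  rw [pow_succ', sq_abs]
  exact mul_le_mul_of_nonneg_right (hYb ω) (sq_nonneg _)

theorem tendsto_integral_cexp_pow {Ω : Type*} [MeasurableSpace Ω] {P : Measure Ω}
    [IsProbabilityMeasure P] {Y : ℕ → Ω → ℝ} (hY : ∀ n, AEStronglyMeasurable (Y n) P)
    {b : ℕ → ℝ} (hb : Tendsto b atTop (𝓝 0)) (hYb : ∀ n ω, |Y n ω| ≤ b n) {v : ℝ}
    (h1 : Tendsto (fun n : ℕ => (n : ℝ) * ∫ ω, Y n ω ∂P) atTop (𝓝 0))
    (h2 : Tendsto (fun n : ℕ => (n : ℝ) * ∫ ω, Y n ω ^ 2 ∂P) atTop (𝓝 v)) :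
    Tendsto (fun n : ℕ => (∫ ω, Complex.exp (Y n ω * Complex.I) ∂P) ^ n) atTop
      (𝓝 (Complex.exp (-(v / 2 : ℝ)))) := by
  set φ : ℕ → ℂ := fun n => ∫ ω, Complex.exp (Y n ω * Complex.I) ∂P with hφ
  set q : ℕ → ℂ := fun n => (∫ ω, Y n ω ∂P : ℝ) * Complex.I - (∫ ω, Y n ω ^ 2 ∂P : ℝ) / 2 with hq
  have hq_lim : Tendsto (fun n : ℕ => (n : ℂ) * q n) atTop (𝓝 (-(v / 2 : ℝ))) := by
    have h1' := ((Complex.continuous_ofReal.tendsto _).comp h1).mul_const Complex.I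
    have h2' := ((Complex.continuous_ofReal.tendsto _).comp h2).div_const 2
    have := h1'.sub h2'
    convert! this using 2 with n
    · simp [hq]; ring
    · simp
  have herr : Tendsto (fun n : ℕ => (n : ℂ) * (φ n - 1 - q n)) atTop (𝓝 0) := by
    have hlim := hb.mul h2
    rw [zero_mul] at hlim
    refine squeeze_zero_norm' ?_ hlim
    filter_upwards [hb.eventually_le_const zero_lt_one] with n hn
    have := norm_integral_cexp_sub_quadratic_le (hY n) hn (hYb n)
    rw [norm_mul, Complex.norm_natCast]
    calc (n : ℝ) * ‖φ n - 1 - q n‖ ≤ n * (b n * ∫ ω, Y n ω ^ 2 ∂P) := by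
          refine mul_le_mul_of_nonneg_left ?_ (Nat.cast_nonneg n)
          convert! this using 2
          simp only [hφ, hq]
          ring
      _ = _ := by ring
  have := Complex.tendsto_one_add_pow_exp_of_tendsto (g := fun n => φ n - 1)
    (t := -(v / 2 : ℝ)) (by
      have := herr.add hq_lim
      rw [zero_add] at this
      exact this.congr fun n => by ring)
  exact this.congr fun n => by simp [hφ]

/-- A central limit theorem for row sums of uniformly small, identically distributed rows. -/
theorem tendstoInDistribution_rowSum {α ΩU Ω Ξ E : Type*} [MeasurableSpace α] [MeasurableSpace ΩU]
    [MeasurableSpace Ω] [MeasurableSpace Ξ] {PU : Measure ΩU} {P : Measure Ω} {Q : Measure Ξ}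
    [IsProbabilityMeasure PU] [IsProbabilityMeasure P] [IsProbabilityMeasure Q]
    [NormedAddCommGroup E] [InnerProductSpace ℝ E] [FiniteDimensional ℝ E] [MeasurableSpace E]
    [BorelSpace E] {U : ΩU → α} {X : ℕ → Ω → α} (hXU : ∀ i, IdentDistrib (X i) U P PU)
    (hX : iIndepFun X P) {F : ℕ → α → E} (hF : ∀ n, Measurable (F n))
    {b : ℕ → ℝ} (hb : Tendsto b atTop (𝓝 0)) (hFb : ∀ n x, ‖F n x‖ ≤ b n)
    {v : E → ℝ}
    (h1 : ∀ t, Tendsto (fun n : ℕ => (n : ℝ) * ∫ ω, inner ℝ (F n (U ω)) t ∂PU) atTop (𝓝 0))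
    (h2 : ∀ t, Tendsto (fun n : ℕ => (n : ℝ) * ∫ ω, inner ℝ (F n (U ω)) t ^ 2 ∂PU) atTop (𝓝 (v t)))
    {G : Ξ → E} (hG : AEMeasurable G Q)
    (hGv : ∀ t, charFun (Q.map G) t = Complex.exp (-(v t / 2 : ℝ))) :
    TendstoInDistribution (fun (n : ℕ) ω => ∑ i ∈ Finset.range n, F n (X i ω)) atTop G
      (fun _ => P) Q where
  forall_aemeasurable n := Finset.aemeasurable_fun_sum _ fun i _ =>
    (hF n).comp_aemeasurable (hXU i).aemeasurable_fst
  aemeasurable_limit := hG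
  tendsto := by
    have : ProperSpace E := FiniteDimensional.proper_rclike ℝ E
    have : SecondCountableTopology E := secondCountable_of_proper
    refine ProbabilityMeasure.tendsto_iff_tendsto_charFun.2 fun t => ?_
    simp only [ProbabilityMeasure.coe_mk]
    rw [hGv]
    have hU : AEMeasurable U PU := (hXU 0).aemeasurable_snd
    have key := tendsto_integral_cexp_pow (P := PU) (Y := fun n ω => inner ℝ (F n (U ω)) t)
      (b := fun n => b n * ‖t‖)
      (fun n => by
        have := ((hF n).comp_aemeasurable hU).aestronglyMeasurable
        exact this.inner aestronglyMeasurable_const)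
      (by simpa using hb.mul_const ‖t‖)
      (fun n ω => (abs_real_inner_le_norm _ _).trans
        (mul_le_mul_of_nonneg_right (hFb n _) (norm_nonneg _))) (h1 t) (h2 t)
    refine key.congr fun n => ?_
    have hind : iIndepFun (fun i ω => F n (X i ω)) P := hX.comp (fun _ => F n) fun _ => hF n
    have hid (i : ℕ) : P.map (fun ω => F n (X i ω)) = PU.map (fun ω => F n (U ω)) :=
      ((hXU i).comp (hF n)).map_eq
    rw [(hind.restrict _).charFun_map_fun_finsetSum_eq_prod (X := fun i ω => F n (X i ω))
      (fun i _ => (hF n).comp_aemeasurable (hXU i).aemeasurable_fst)]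
    simp only [hid, Finset.prod_const, Finset.card_range, Pi.pow_apply]
    have hm : AEMeasurable (fun ω => F n (U ω)) PU := (hF n).comp_aemeasurable hU
    rw [charFun_apply, integral_map hm (by fun_prop)]

/-- Chebyshev: the mean of the row sum tends to `m` and its variance is at most `n` times the second
moment. -/
theorem tendstoInMeasure_rowSum {α ΩU Ω : Type*} [MeasurableSpace α] [MeasurableSpace ΩU]
    [MeasurableSpace Ω] {PU : Measure ΩU} {P : Measure Ω}
    [IsProbabilityMeasure PU] [IsProbabilityMeasure P]
    {U : ΩU → α} {X : ℕ → Ω → α} (hXU : ∀ i, IdentDistrib (X i) U P PU)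
    (hX : iIndepFun X P) {F : ℕ → α → ℝ} (hF : ∀ n, Measurable (F n))
    {b : ℕ → ℝ} (hFb : ∀ n x, |F n x| ≤ b n) {m : ℝ}
    (h1 : Tendsto (fun n : ℕ => (n : ℝ) * ∫ ω, F n (U ω) ∂PU) atTop (𝓝 m))
    (h2 : Tendsto (fun n : ℕ => (n : ℝ) * ∫ ω, F n (U ω) ^ 2 ∂PU) atTop (𝓝 0)) :
    TendstoInMeasure P (fun (n : ℕ) ω => ∑ i ∈ Finset.range n, F n (X i ω)) atTop (fun _ => m) := by
  rw [tendstoInMeasure_iff_norm]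
  intro ε hε
  have hmem (n i : ℕ) : MemLp (fun ω => F n (X i ω)) 2 P :=
    MemLp.of_bound ((hF n).comp_aemeasurable (hXU i).aemeasurable_fst).aestronglyMeasurable (b n)
      (ae_of_all _ fun ω => hFb n _)
  have hid (n i : ℕ) : IdentDistrib (fun ω => F n (X i ω)) (fun ω => F n (U ω)) P PU :=
    (hXU i).comp (hF n)
  have hE (n : ℕ) : ∫ ω, ∑ i ∈ Finset.range n, F n (X i ω) ∂P = n * ∫ ω, F n (U ω) ∂PU := by
    rw [integral_finsetSum _ fun i _ => (hmem n i).integrable (by norm_num)]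
    simp [fun i => (hid n i).integral_eq]
  have hV (n : ℕ) : Var[fun ω => ∑ i ∈ Finset.range n, F n (X i ω); P]
      ≤ n * ∫ ω, F n (U ω) ^ 2 ∂PU := by
    have hind : iIndepFun (fun i ω => F n (X i ω)) P := hX.comp (fun _ => F n) fun _ => hF n
    have := IndepFun.variance_sum (s := Finset.range n) (fun i _ => hmem n i)
      fun i _ j _ hij => hind.indepFun hij
    have e : (∑ i ∈ Finset.range n, fun ω => F n (X i ω))
      = fun ω => ∑ i ∈ Finset.range n, F n (X i ω) := by ext; simp
    rw [← e, this]
    simp only [fun i => (hid n i).variance_eq, Finset.sum_const, Finset.card_range, nsmul_eq_mul]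
    refine mul_le_mul_of_nonneg_left ?_ (Nat.cast_nonneg n)
    exact variance_le_expectation_sq (hid n 0).aemeasurable_snd.aestronglyMeasurable
  have hlim : Tendsto (fun n : ℕ => ENNReal.ofReal
      ((n * ∫ ω, F n (U ω) ^ 2 ∂PU) / (ε / 2) ^ 2)) atTop (𝓝 0) := by
    have := ENNReal.tendsto_ofReal (h2.div_const ((ε / 2) ^ 2))
    simpa using this
  refine tendsto_of_tendsto_of_tendsto_of_le_of_le' tendsto_const_nhds hlim
    (Eventually.of_forall fun _ => zero_le) ?_
  filter_upwards [Metric.tendsto_nhds.mp h1 (ε / 2) (half_pos hε)] with n hn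
  have hcheb := meas_ge_le_variance_div_sq (μ := P)
    (memLp_finsetSum (Finset.range n) fun i _ => hmem n i) (half_pos hε)
  refine le_trans (measure_mono fun ω hω => ?_) (hcheb.trans (ENNReal.ofReal_le_ofReal
    (div_le_div_of_nonneg_right (hV n) (by positivity))))
  simp only [Set.mem_ofPred_eq, Real.norm_eq_abs] at hω ⊢
  rw [hE]
  rw [Real.dist_eq] at hn
  have := abs_sub_le (∑ i ∈ Finset.range n, F n (X i ω)) (n * ∫ ω, F n (U ω) ∂PU) m
  linarith

theorem tendstoInMeasure_inv_one {Ω ι : Type*} [MeasurableSpace Ω] {P : Measure Ω}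
    {M : ι → Ω → ℝ} {l : Filter ι} (h : TendstoInMeasure P M l fun _ => 1) :
    TendstoInMeasure P (fun n ω => (M n ω)⁻¹) l fun _ => 1 := by
  rw [tendstoInMeasure_iff_norm] at h ⊢
  intro ε hε
  -- Within `1/2` of `1` the value exceeds `1/2`, so inversion at most doubles the distance to `1`.
  have := h (min (1 / 2) (ε / 2)) (by positivity)
  refine tendsto_of_tendsto_of_tendsto_of_le_of_le tendsto_const_nhds this
    (fun _ => zero_le) fun n => measure_mono fun ω hω => ?_
  simp only [Set.mem_ofPred_eq, Real.norm_eq_abs] at hω ⊢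
  by_contra! hlt
  rw [lt_min_iff] at hlt
  have hM := abs_lt.mp hlt.1
  have hpos : 1 / 2 < M n ω := by linarith
  have e : (M n ω)⁻¹ - 1 = -(M n ω - 1) / M n ω := by
    have : M n ω ≠ 0 := by linarith
    field_simp; ring
  rw [e, abs_div, abs_neg, abs_of_pos (by linarith : 0 < M n ω), le_div_iff₀ (by linarith)] at hω
  nlinarith [hlt.2]

theorem charFun_toLp_mul_gaussian {Ξ ι : Type*} [Fintype ι] [MeasurableSpace Ξ] {Q : Measure Ξ}
    [IsProbabilityMeasure Q] {ξ : ι → Ξ → ℝ} (hξ : ∀ i, HasLaw (ξ i) (gaussianReal 0 1) Q)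
    (hind : iIndepFun ξ Q) (σ : ι → ℝ) (t : EuclideanSpace ℝ ι) :
    charFun (Q.map fun ω => WithLp.toLp 2 fun i => σ i * ξ i ω) t
      = Complex.exp (-((∑ i, σ i ^ 2 * t i ^ 2) / 2 : ℝ)) := by
  have hind' : iIndepFun (fun i ω => σ i * ξ i ω) Q :=
    hind.comp (fun i x => σ i * x) fun i => measurable_const_mul _
  have hm (i) : AEMeasurable (fun ω => σ i * ξ i ω) Q := (hξ i).aemeasurable.const_mul _
  rw [(iIndepFun_iff_charFun_pi hm).mp hind' t]
  simp_rw [fun i => charFun_map_mul_comp (hξ i).aemeasurable (σ i) (t i), (hξ _).map_eq,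
    charFun_gaussianReal, ← Complex.exp_sum]
  congr 1
  push_cast
  rw [Finset.sum_div, ← Finset.sum_neg_distrib]
  exact Finset.sum_congr rfl fun i _ => by simp; ring

/-! ### Sojourn times and exceedances -/

/-- The indicator that the sojourn time of the path `u` above `1 - c` is positive. -/
noncomputable def exceedance (u : C(unitInterval, ℝ)) (c : ℝ) : ℝ :=
  (Set.Ioc (0 : ℝ) 1).indicator (fun _ => (1 : ℝ)) (sojournTime u (-c))

theorem exceedanceCount_eq_sum (u : ℕ → C(unitInterval, ℝ)) (n j : ℕ) (c : ℝ) :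
    exceedanceCount u n j c = ∑ i ∈ Finset.range n, exceedance (u i) (c / j) := rfl

theorem measurable_sojournTime (s : ℝ) : Measurable fun u => sojournTime u s := by
  have h1 : Measurable fun p : C(unitInterval, ℝ) × unitInterval => p.1 p.2 - 1 := by
    have : Continuous fun p : C(unitInterval, ℝ) × unitInterval => p.1 p.2 := by fun_prop
    exact this.measurable.sub_const 1
  have h2 : Measurable fun p : C(unitInterval, ℝ) × unitInterval =>
      (Set.Ioi s).indicator (fun _ => (1 : ℝ)) (p.1 p.2 - 1) :=
    (measurable_const.indicator measurableSet_Ioi).comp h1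
  exact h2.stronglyMeasurable.integral_prod_right.measurable

theorem measurable_exceedance (c : ℝ) : Measurable fun u => exceedance u c :=
  (measurable_const.indicator measurableSet_Ioc).comp (measurable_sojournTime (-c))

theorem sojournTime_eq_measureReal (u : C(unitInterval, ℝ)) (s : ℝ) :
    sojournTime u s = (volume : Measure unitInterval).real {t | 1 + s < u t} := by
  have hm : MeasurableSet {t : unitInterval | 1 + s < u t} :=
    (isOpen_lt continuous_const u.continuous).measurableSet
  rw [sojournTime, ← integral_indicator_one hm]
  congr 1
  ext t
  simp only [Set.indicator_apply, Set.mem_Ioi, lt_sub_iff_add_lt', Set.mem_ofPred_eq, Pi.one_apply]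

instance isOpenPosMeasure_unitInterval : (volume : Measure unitInterval).IsOpenPosMeasure where
  open_pos s hs hne := by
    obtain ⟨a, b, hab, h⟩ := hs.exists_Ioo_subset hne
    refine (lt_of_lt_of_le ?_ (measure_mono h)).ne'
    rw [unitInterval.volume_Ioo, ENNReal.ofReal_pos, sub_pos]
    exact hab

open Classical in
-- By continuity the superlevel set is open, so it has positive measure as soon as it is nonempty;
-- the upper bound `1` always holds for a probability measure.
theorem exceedance_eq_ite (u : C(unitInterval, ℝ)) (c : ℝ) :
    exceedance u c = if ∃ t, 1 - c < u t then 1 else 0 := by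
  rw [exceedance, sojournTime_eq_measureReal, Set.indicator_apply]
  refine if_congr ?_ rfl rfl
  rw [Set.mem_Ioc, and_iff_left measureReal_le_one, ← sub_eq_add_neg]
  have ho : IsOpen {t : unitInterval | 1 - c < u t} := isOpen_lt continuous_const u.continuous
  rw [measureReal_def, ENNReal.toReal_pos_iff, and_iff_left (measure_lt_top _ _),
    ho.measure_pos_iff volume]
  rfl

theorem exceedance_mul_of_le (u : C(unitInterval, ℝ)) {c c' : ℝ} (h : c ≤ c') :
    exceedance u c * exceedance u c' = exceedance u c := by
  classical
  simp only [exceedance_eq_ite]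
  split_ifs with h1 h2 h2
  · simp
  · obtain ⟨t, ht⟩ := h1
    exact absurd ⟨t, by linarith⟩ h2
  · simp
  · simp

theorem exceedance_nonneg (u : C(unitInterval, ℝ)) (c : ℝ) : 0 ≤ exceedance u c :=
  Set.indicator_nonneg (fun _ _ => zero_le_one) _

theorem exceedance_le_one (u : C(unitInterval, ℝ)) (c : ℝ) : exceedance u c ≤ 1 := by
  classical
  rw [exceedance_eq_ite]
  split_ifs <;> simp

section Moments

variable {Ω : Type*} [MeasurableSpace Ω] {P : Measure Ω} [IsProbabilityMeasure P]
  {U : Ω → C(unitInterval, ℝ)}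

theorem integrable_exceedance (hU : AEMeasurable U P) (c : ℝ) :
    Integrable (fun ω => exceedance (U ω) c) P :=
  Integrable.of_bound ((measurable_exceedance c).comp_aemeasurable hU).aestronglyMeasurable 1
    (ae_of_all _ fun ω => by
      rw [Real.norm_of_nonneg (exceedance_nonneg _ _)]; exact exceedance_le_one _ _)

theorem integral_exceedance (hU : Measurable U) (c : ℝ) :
    ∫ ω, exceedance (U ω) c ∂P = 1 - pathCdf P U fun _ => 1 - c := by
  classical
  have hm : MeasurableSet {ω | ∀ t, U ω t ≤ 1 - c} := by
    have : IsClosed {u : C(unitInterval, ℝ) | ∀ t, u t ≤ 1 - c} := by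
      simp only [Set.ofPred_forall]
      exact isClosed_iInter fun t => isClosed_le (by fun_prop) continuous_const
    exact hU this.measurableSet
  rw [pathCdf, ← probReal_compl_eq_one_sub hm, ← integral_indicator_one hm.compl]
  congr 1
  ext ω
  rw [exceedance_eq_ite, Set.indicator_apply]
  refine if_congr ?_ rfl rfl
  simp only [Set.mem_compl_iff, Set.mem_ofPred_eq, not_forall, not_le]

end Moments

/-! ### Tail expansion from the `δ`-neighborhood -/

theorem dNorm_const {Ω : Type*} [MeasurableSpace Ω] (P : Measure Ω)
    (Z : Ω → C(unitInterval, ℝ)) {c : ℝ} (hc : 0 ≤ c) :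
    dNorm P Z (fun _ => -c) = c * generatorConstant P Z := by
  rw [dNorm, generatorConstant, ← integral_const_mul]
  congr 1
  ext ω
  rw [abs_neg, abs_of_nonneg hc, Real.mul_iSup_of_nonneg hc]

/-- The supremum dominates the value at `0`, which has mean one. This makes the scale `n c m_D`
positive. -/
theorem one_le_generatorConstant {Ω : Type*} [MeasurableSpace Ω] {P : Measure Ω}
    [IsProbabilityMeasure P] {Z : Ω → C(unitInterval, ℝ)} (hZ : IsGenerator P Z) :
    1 ≤ generatorConstant P Z := by
  obtain ⟨q, hq⟩ := hZ.bounded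
  have hbdd (ω) : BddAbove (Set.range fun t => Z ω t) :=
    ⟨q, by rintro _ ⟨t, rfl⟩; exact (hq ω t).2⟩
  have hle (ω) (t) : Z ω t ≤ ⨆ t, Z ω t := le_ciSup (hbdd ω) t
  have hnorm (ω) : ⨆ t, Z ω t = ‖Z ω‖ := by
    rw [ContinuousMap.norm_eq_iSup_norm]
    congr 1
    ext t
    rw [Real.norm_of_nonneg (hq ω t).1]
  have hsup : Integrable (fun ω => ⨆ t, Z ω t) P := by
    refine Integrable.of_bound ?_ q (ae_of_all _ fun ω => ?_)
    · simp_rw [hnorm]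
      exact hZ.measurable.norm.aestronglyMeasurable
    · rw [Real.norm_of_nonneg ((hq ω 0).1.trans (hle ω 0))]
      exact ciSup_le fun t => (hq ω t).2
  -- A non-integrable function would have integral `0` by convention, contradicting mean one.
  have h0 : Integrable (fun ω => Z ω 0) P := by
    by_contra h
    have := hZ.mean_one 0
    rw [integral_undef h] at this
    exact zero_ne_one this
  rw [← hZ.mean_one 0]
  exact integral_mono h0 hsup fun ω => hle ω 0

theorem one_sub_pathCdf_const_isBigO {ΩU ΩV ΩZ : Type*} [MeasurableSpace ΩU] [MeasurableSpace ΩV]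
    [MeasurableSpace ΩZ] {PU : Measure ΩU} {PV : Measure ΩV} {PZ : Measure ΩZ}
    {U : ΩU → C(unitInterval, ℝ)} {V : ΩV → C(unitInterval, ℝ)} {Z : ΩZ → C(unitInterval, ℝ)}
    {δ : ℝ} (hV : IsGPCP PV V PZ Z) (hUV : InDeltaNeighborhood PU U PV V δ) :
    (fun c : ℝ => 1 - pathCdf PU U (fun _ => 1 - c) - c * generatorConstant PZ Z)
      =O[𝓝[>] 0] fun c : ℝ => c ^ (1 + δ) := by
  have hmem (c : ℝ) (hc : 0 ≤ c) : (fun _ => -c : unitInterval → ℝ) ∈ EMinus :=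
    ⟨⟨|c|, fun t => by simp⟩, by simp [continuousAt_const], fun t => by simpa⟩
  have h := hUV (fun _ => -1) (hmem 1 zero_le_one)
  obtain ⟨ε, hε, hpar⟩ := hV.pareto
  refine h.neg_left.congr' ?_ EventuallyEq.rfl
  filter_upwards [Ioo_mem_nhdsGT hε] with c hc
  have hV' := hpar (fun _ => -c) (hmem c hc.1.le) fun t => by
    rw [abs_neg, abs_of_pos hc.1]; exact hc.2.le
  rw [dNorm_const PZ Z hc.1.le] at hV'
  simp only [mul_neg, mul_one, ← sub_eq_add_neg] at hV' ⊢
  rw [hV']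
  ring

theorem remainderTerm_isBigO {Ω : Type*} [MeasurableSpace Ω] {P : Measure Ω}
    {U : Ω → C(unitInterval, ℝ)} {m δ : ℝ}
    (h : (fun c : ℝ => 1 - pathCdf P U (fun _ => 1 - c) - c * m)
      =O[𝓝[>] 0] fun c : ℝ => c ^ (1 + δ)) :
    (fun s : ℝ => remainderTerm P U m s) =O[𝓝[<] 0] fun s : ℝ => |s| ^ δ := by
  have hneg : Tendsto (fun s : ℝ => -s) (𝓝[<] 0) (𝓝[>] 0) := by
    simpa using tendsto_neg_nhdsLT (a := (0 : ℝ))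
  have h1 := (h.comp_tendsto hneg).mul (isBigO_refl (fun s : ℝ => (-s)⁻¹) (𝓝[<] 0))
  refine h1.congr' ?_ ?_ <;> filter_upwards [self_mem_nhdsWithin] with s hs <;>
    rw [Set.mem_Iio] at hs
  · simp only [Function.comp_apply, remainderTerm, abs_of_neg hs]
    simp only [sub_neg_eq_add]
    have := hs.ne
    field_simp
    ring
  · simp only [Function.comp_apply, abs_of_neg hs]
    rw [Real.rpow_add (by linarith), Real.rpow_one]
    have := hs.ne
    field_simp

/-! ### Weighted exceedances and the test statistic -/

/-- The exceedance indicators above `1 - c / (j + 1)`, weighted by `j + 1`. -/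
noncomputable def weightedExceedance (u : C(unitInterval, ℝ)) (j : ℕ) (c : ℝ) : ℝ :=
  ((j + 1 : ℕ) : ℝ) * exceedance u (c / ((j + 1 : ℕ) : ℝ))

theorem measurable_weightedExceedance (j : ℕ) (c : ℝ) :
    Measurable fun u => weightedExceedance u j c :=
  (measurable_exceedance _).const_mul _

theorem weightedExceedance_nonneg (u : C(unitInterval, ℝ)) (j : ℕ) (c : ℝ) :
    0 ≤ weightedExceedance u j c :=
  mul_nonneg (Nat.cast_nonneg _) (exceedance_nonneg _ _)

theorem weightedExceedance_le (u : C(unitInterval, ℝ)) (j : ℕ) (c : ℝ) :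
    weightedExceedance u j c ≤ ((j + 1 : ℕ) : ℝ) :=
  mul_le_of_le_one_right (Nat.cast_nonneg _) (exceedance_le_one _ _)

/-- The exceedance events are nested, so the product of indicators is that of the higher level; this
is the source of the kernel `min`, and it makes second moments linear in first moments. -/
theorem weightedExceedance_mul (u : C(unitInterval, ℝ)) (j l : ℕ) {c : ℝ} (hc : 0 ≤ c) :
    weightedExceedance u j c * weightedExceedance u l c
      = ((min j l + 1 : ℕ) : ℝ) * weightedExceedance u (max j l) c := by
  wlog h : j ≤ l generalizing j l
  · rw [mul_comm, min_comm, max_comm]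
    exact this l j (le_of_not_ge h)
  rw [min_eq_left h, max_eq_right h, weightedExceedance, weightedExceedance, mul_mul_mul_comm,
    mul_comm (exceedance _ _), exceedance_mul_of_le]
  · ring
  · gcongr

theorem sum_Icc_one_eq_sum_range {M : Type*} [AddCommMonoid M] (f : ℕ → M) (k : ℕ) :
    ∑ j ∈ Finset.Icc 1 k, f j = ∑ j ∈ Finset.range k, f (j + 1) := by
  rw [Finset.range_eq_Ico, Finset.sum_Ico_add' f 0 k 1]
  rfl

theorem mul_exceedanceCount_eq (u : ℕ → C(unitInterval, ℝ)) (n j : ℕ) (c : ℝ) :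
    ((j + 1 : ℕ) : ℝ) * exceedanceCount u n (j + 1) c
      = ∑ i ∈ Finset.range n, weightedExceedance (u i) j c := by
  rw [exceedanceCount_eq_sum, Finset.mul_sum]
  rfl

theorem meanCount_eq (u : ℕ → C(unitInterval, ℝ)) (k n : ℕ) (c : ℝ) :
    meanCount u k n c
      = 1 / k * ∑ j ∈ Finset.range k, ∑ i ∈ Finset.range n, weightedExceedance (u i) j c := by
  rw [meanCount, sum_Icc_one_eq_sum_range]
  simp_rw [mul_exceedanceCount_eq]

/-- Coordinates of the normalized weighted exceedances of one path in the cosine basis. -/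
noncomputable def cosCoords (k : ℕ) (d c : ℝ) (u : C(unitInterval, ℝ)) :
    EuclideanSpace ℝ (Fin k) :=
  WithLp.toLp 2 fun i => (√d)⁻¹ * ∑ j ∈ Finset.range (k + 1),
    cosVec (k + 1) (i + 1) j * weightedExceedance u j c

/-- The normalized contribution of one path to the mean count. -/
noncomputable def meanContribution (k : ℕ) (d c : ℝ) (u : C(unitInterval, ℝ)) : ℝ :=
  d⁻¹ * (1 / (k : ℝ) * ∑ j ∈ Finset.range k, weightedExceedance u j c)

/-- The scale `d` cancels: squared coordinates and the mean both carry `d⁻¹`. With `0⁻¹ = 0` the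
identity also covers a vanishing mean. -/
theorem testStatistic_eq (u : ℕ → C(unitInterval, ℝ)) (k n : ℕ) (c : ℝ) {d : ℝ} (hd : 0 < d) :
    testStatistic u (k + 1) n c
      = (∑ l : Fin k, (∑ i ∈ Finset.range n, cosCoords k d c (u i)) l ^ 2)
        * (∑ i ∈ Finset.range n, meanContribution (k + 1) d c (u i))⁻¹ := by
  have hM : ∑ i ∈ Finset.range n, meanContribution (k + 1) d c (u i)
      = d⁻¹ * meanCount u (k + 1) n c := by
    simp_rw [meanContribution, ← Finset.mul_sum, meanCount_eq]
    rw [Finset.sum_comm]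
  have hS (l : Fin k) : (∑ i ∈ Finset.range n, cosCoords k d c (u i)) l
      = (√d)⁻¹ * ∑ j ∈ Finset.range (k + 1), cosVec (k + 1) (l + 1) j
        * ∑ i ∈ Finset.range n, weightedExceedance (u i) j c := by
    simp only [cosCoords, WithLp.ofLp_sum, Finset.sum_apply, ← Finset.mul_sum]
    rw [Finset.sum_comm]
    simp_rw [Finset.mul_sum]
  rw [hM]
  simp_rw [hS, mul_pow, ← Finset.mul_sum]
  rw [← sum_sq_sub_mean_eq, testStatistic, sum_Icc_one_eq_sum_range]
  simp_rw [mul_exceedanceCount_eq]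
  simp_rw [← meanCount_eq]
  rw [inv_pow, Real.sq_sqrt hd.le, mul_inv, inv_inv]
  field_simp

theorem measurable_cosCoords (k : ℕ) (d c : ℝ) : Measurable (cosCoords k d c) := by
  refine (WithLp.measurable_toLp 2 _).comp (measurable_pi_lambda _ fun i => ?_)
  exact (Finset.measurable_fun_sum _ fun j _ =>
    (measurable_weightedExceedance j c).const_mul _).const_mul _

theorem measurable_meanContribution (k : ℕ) (d c : ℝ) : Measurable (meanContribution k d c) :=
  ((Finset.measurable_fun_sum _ fun j _ => measurable_weightedExceedance j c).const_mul _).const_mul _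

theorem exists_norm_cosCoords_le (k : ℕ) :
    ∃ C, ∀ d c u, ‖cosCoords k d c u‖ ≤ (√d)⁻¹ * C := by
  let C : Fin k → ℝ := fun i => ∑ j ∈ Finset.range (k + 1),
    |cosVec (k + 1) (i + 1) j| * ((j + 1 : ℕ) : ℝ)
  refine ⟨∑ i, C i, fun d c u => ?_⟩
  have h1 (i : Fin k) : |cosCoords k d c u i| ≤ (√d)⁻¹ * C i := by
    simp only [cosCoords, abs_mul]
    rw [abs_of_nonneg (inv_nonneg.mpr (Real.sqrt_nonneg d))]
    gcongr
    refine (Finset.abs_sum_le_sum_abs _ _).trans (Finset.sum_le_sum fun j _ => ?_)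
    rw [abs_mul, abs_of_nonneg (weightedExceedance_nonneg _ _ _)]
    exact mul_le_mul_of_nonneg_left (weightedExceedance_le _ _ _) (abs_nonneg _)
  have h2 : ‖cosCoords k d c u‖ ≤ ∑ i, |cosCoords k d c u i| := by
    rw [EuclideanSpace.norm_eq]
    refine Real.sqrt_le_iff.mpr ⟨by positivity, ?_⟩
    exact Finset.sum_sq_le_sq_sum_of_nonneg fun i _ => abs_nonneg _
  refine h2.trans ?_
  rw [Finset.mul_sum]
  exact Finset.sum_le_sum fun i _ => h1 i

theorem abs_meanContribution_le (k : ℕ) {d : ℝ} (hd : 0 < d) (c : ℝ) (u : C(unitInterval, ℝ)) :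
    |meanContribution k d c u| ≤ d⁻¹ * k := by
  have h0 : 0 ≤ meanContribution k d c u := by
    have := Finset.sum_nonneg fun j (_ : j ∈ Finset.range k) => weightedExceedance_nonneg u j c
    unfold meanContribution
    positivity
  rw [abs_of_nonneg h0, meanContribution]
  refine mul_le_mul_of_nonneg_left ?_ (by positivity)
  rcases Nat.eq_zero_or_pos k with rfl | hk
  · simp
  have hk' : (0 : ℝ) < k := by exact_mod_cast hk
  have : ∑ j ∈ Finset.range k, weightedExceedance u j c ≤ ∑ j ∈ Finset.range k, (k : ℝ) :=
    Finset.sum_le_sum fun j hj => (weightedExceedance_le u j c).trans (by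
      exact_mod_cast Finset.mem_range.mp hj)
  rw [Finset.sum_const, Finset.card_range, nsmul_eq_mul] at this
  rw [div_mul_eq_mul_div, one_mul, div_le_iff₀ hk']
  exact this

theorem inner_cosCoords (k : ℕ) (d c : ℝ) (u : C(unitInterval, ℝ)) (t : EuclideanSpace ℝ (Fin k)) :
    inner ℝ (cosCoords k d c u) t = (√d)⁻¹ * ∑ j ∈ Finset.range (k + 1),
      (∑ i : Fin k, t i * cosVec (k + 1) (i + 1) j) * weightedExceedance u j c := by
  simp only [PiLp.inner_apply, cosCoords, RCLike.inner_apply, conj_trivial]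
  simp_rw [Finset.sum_mul, Finset.mul_sum]
  rw [Finset.sum_comm]
  exact Finset.sum_congr rfl fun j _ => Finset.sum_congr rfl fun i _ => by ring

theorem inner_cosCoords_sq (k : ℕ) {d c : ℝ} (hd : 0 < d) (hc : 0 ≤ c) (u : C(unitInterval, ℝ))
    (t : EuclideanSpace ℝ (Fin k)) :
    inner ℝ (cosCoords k d c u) t ^ 2 = ∑ j ∈ Finset.range (k + 1), ∑ l ∈ Finset.range (k + 1),
      ((∑ i : Fin k, t i * cosVec (k + 1) (i + 1) j)
        * (∑ i : Fin k, t i * cosVec (k + 1) (i + 1) l) * ((min j l + 1 : ℕ) : ℝ))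
      * (d⁻¹ * weightedExceedance u (max j l) c) := by
  rw [inner_cosCoords, mul_pow, inv_pow, Real.sq_sqrt hd.le, sq (Finset.sum _ _),
    Finset.sum_mul_sum, Finset.mul_sum]
  refine Finset.sum_congr rfl fun j _ => ?_
  rw [Finset.mul_sum]
  refine Finset.sum_congr rfl fun l _ => ?_
  rw [mul_mul_mul_comm, weightedExceedance_mul u j l hc]
  ring

/-! ### Asymptotics of the moments -/

section Limits

variable {Ω : Type*} [MeasurableSpace Ω] {P : Measure Ω} [IsProbabilityMeasure P]
  {U : Ω → C(unitInterval, ℝ)}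

theorem integrable_weightedExceedance (hU : AEMeasurable U P) (j : ℕ) (c : ℝ) :
    Integrable (fun ω => weightedExceedance (U ω) j c) P :=
  (integrable_exceedance hU _).const_mul _

/-- The weight `j + 1` undoes the division of `c` by `j + 1`, so the leading term does not depend on
`j`. -/
theorem integral_weightedExceedance_sub_isBigO (hU : Measurable U) {m δ : ℝ}
    (h : (fun c : ℝ => 1 - pathCdf P U (fun _ => 1 - c) - c * m)
      =O[𝓝[>] 0] fun c : ℝ => c ^ (1 + δ)) (j : ℕ) :
    (fun c => ∫ ω, weightedExceedance (U ω) j c ∂P - c * m)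
      =O[𝓝[>] 0] fun c : ℝ => c ^ (1 + δ) := by
  have hj : (0 : ℝ) < ((j + 1 : ℕ) : ℝ) := by positivity
  have ht : Tendsto (fun c : ℝ => c / ((j + 1 : ℕ) : ℝ)) (𝓝[>] 0) (𝓝[>] 0) := by
    refine tendsto_nhdsWithin_iff.mpr ⟨?_, ?_⟩
    · have : Tendsto (fun c : ℝ => c / ((j + 1 : ℕ) : ℝ)) (𝓝 0) (𝓝 0) := by
        simpa using (tendsto_id (x := 𝓝 (0 : ℝ))).div_const ((j + 1 : ℕ) : ℝ)
      exact this.mono_left nhdsWithin_le_nhds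
    · filter_upwards [self_mem_nhdsWithin] with c hc
      exact div_pos hc hj
  have h1 := (h.comp_tendsto ht).const_mul_left ((j + 1 : ℕ) : ℝ)
  have h2 : ((fun c : ℝ => c ^ (1 + δ)) ∘ fun c : ℝ => c / ((j + 1 : ℕ) : ℝ))
      =O[𝓝[>] 0] fun c : ℝ => c ^ (1 + δ) := by
    refine IsBigO.of_bound (((j + 1 : ℕ) : ℝ) ^ (1 + δ))⁻¹ ?_
    filter_upwards [self_mem_nhdsWithin] with c hc
    rw [Set.mem_Ioi] at hc
    simp only [Function.comp_apply]
    rw [Real.div_rpow hc.le hj.le, norm_div, div_eq_inv_mul,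
      Real.norm_of_nonneg (Real.rpow_nonneg hj.le _)]
  refine (h1.trans h2).congr_left fun c => ?_
  simp only [Function.comp_apply, weightedExceedance]
  rw [integral_const_mul, integral_exceedance hU]
  field_simp

variable {c d : ℕ → ℝ} {m δ : ℝ}

theorem tendsto_mul_integral_weightedExceedance_sub_div_sqrt (hU : Measurable U)
    (h : (fun c : ℝ => 1 - pathCdf P U (fun _ => 1 - c) - c * m)
      =O[𝓝[>] 0] fun c : ℝ => c ^ (1 + δ)) (hm : 0 < m)
    (hc : Tendsto c atTop (𝓝[>] 0)) (hd : ∀ᶠ n in atTop, d n = n * c n * m)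
    (hδ : Tendsto (fun n : ℕ => (n : ℝ) * c n ^ (1 + 2 * δ)) atTop (𝓝 0)) (j : ℕ) :
    Tendsto (fun n : ℕ => (n : ℝ) * (∫ ω, weightedExceedance (U ω) j (c n) ∂P - c n * m)
      * (√(d n))⁻¹) atTop (𝓝 0) := by
  have h1 := (integral_weightedExceedance_sub_isBigO hU h j).comp_tendsto hc
  have h2 := ((isBigO_refl (fun n : ℕ => (n : ℝ)) atTop).mul h1).mul
    (isBigO_refl (fun n : ℕ => (√(d n))⁻¹) atTop)
  refine h2.trans_tendsto ?_
  -- The normalized bias `n c^(1+δ) / √(n c m)` equals this root; here the rate condition on `c`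
  -- enters.
  have h3 : Tendsto (fun n : ℕ => √((n : ℝ) * c n ^ (1 + 2 * δ) / m)) atTop (𝓝 0) := by
    simpa using (hδ.div_const m).sqrt
  refine h3.congr' ?_
  filter_upwards [hd, hc.eventually self_mem_nhdsWithin, eventually_gt_atTop 0] with n hn hcn hn0
  have hn0' : (0 : ℝ) < n := by exact_mod_cast hn0
  simp only [Function.comp_apply]
  rw [hn, Real.sqrt_eq_iff_eq_sq (by positivity) (by positivity), mul_pow, mul_pow, inv_pow,
    Real.sq_sqrt (by positivity), ← Real.rpow_natCast (c n ^ (1 + δ)), ← Real.rpow_mul hcn.le]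
  have e : (1 + δ) * ((2 : ℕ) : ℝ) = 1 + 2 * δ + 1 := by push_cast; ring
  rw [e, Real.rpow_add_one hcn.ne']
  field_simp

theorem tendsto_mul_integral_weightedExceedance_div (hU : Measurable U)
    (h : (fun c : ℝ => 1 - pathCdf P U (fun _ => 1 - c) - c * m)
      =O[𝓝[>] 0] fun c : ℝ => c ^ (1 + δ)) (hm : 0 < m)
    (hc : Tendsto c atTop (𝓝[>] 0)) (hd : ∀ᶠ n in atTop, d n = n * c n * m)
    (hdt : Tendsto d atTop atTop)
    (hδ : Tendsto (fun n : ℕ => (n : ℝ) * c n ^ (1 + 2 * δ)) atTop (𝓝 0)) (j : ℕ) :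
    Tendsto (fun n : ℕ => (n : ℝ) * ((d n)⁻¹ * ∫ ω, weightedExceedance (U ω) j (c n) ∂P))
      atTop (𝓝 1) := by
  have h1 := (tendsto_mul_integral_weightedExceedance_sub_div_sqrt hU h hm hc hd hδ j).mul
    (tendsto_inv_atTop_zero.comp (Real.tendsto_sqrt_atTop.comp hdt))
  have h2 := h1.add (tendsto_const_nhds (x := (1 : ℝ)))
  rw [zero_mul, zero_add] at h2
  refine h2.congr' ?_
  filter_upwards [hd, hdt.eventually_gt_atTop 0] with n hn hpos
  simp only [Function.comp_apply]
  have hs : (√(d n))⁻¹ * (√(d n))⁻¹ = (d n)⁻¹ := by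
    rw [← mul_inv, Real.mul_self_sqrt hpos.le]
  have h1 : (d n)⁻¹ * (n * c n * m) = 1 := by rw [← hn]; exact inv_mul_cancel₀ hpos.ne'
  linear_combination (n : ℝ) * (∫ ω, weightedExceedance (U ω) j (c n) ∂P - c n * m) * hs - h1

theorem tendsto_mul_integral_inner_cosCoords (hU : Measurable U)
    (h : (fun c : ℝ => 1 - pathCdf P U (fun _ => 1 - c) - c * m)
      =O[𝓝[>] 0] fun c : ℝ => c ^ (1 + δ)) (hm : 0 < m)
    (hc : Tendsto c atTop (𝓝[>] 0)) (hd : ∀ᶠ n in atTop, d n = n * c n * m)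
    (hδ : Tendsto (fun n : ℕ => (n : ℝ) * c n ^ (1 + 2 * δ)) atTop (𝓝 0))
    (k : ℕ) (t : EuclideanSpace ℝ (Fin k)) :
    Tendsto (fun n : ℕ => (n : ℝ) * ∫ ω, inner ℝ (cosCoords k (d n) (c n) (U ω)) t ∂P)
      atTop (𝓝 0) := by
  set β : ℕ → ℝ := fun j => ∑ i : Fin k, t i * cosVec (k + 1) (i + 1) j with hβ
  -- Coefficients summing to zero annihilate the common mean `c n * m`, which alone would diverge
  -- after scaling.
  have hβ0 : ∑ j ∈ Finset.range (k + 1), β j = 0 := by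
    rw [Finset.sum_comm]
    refine Finset.sum_eq_zero fun i _ => ?_
    rw [← Finset.mul_sum, sum_cosVec (by omega) (by omega), mul_zero]
  have hlim := tendsto_finsetSum (Finset.range (k + 1)) fun j _ =>
    (tendsto_mul_integral_weightedExceedance_sub_div_sqrt hU h hm hc hd hδ j).const_mul (β j)
  simp only [mul_zero, Finset.sum_const_zero] at hlim
  refine hlim.congr fun n => ?_
  simp_rw [inner_cosCoords]
  rw [integral_const_mul, integral_finsetSum _ fun j _ =>
    (integrable_weightedExceedance hU.aemeasurable j (c n)).const_mul _]
  simp_rw [integral_const_mul]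
  have e (j : ℕ) : β j * (n * (∫ ω, weightedExceedance (U ω) j (c n) ∂P - c n * m) * (√(d n))⁻¹)
      = n * (√(d n))⁻¹ * (β j * ∫ ω, weightedExceedance (U ω) j (c n) ∂P)
        - n * (√(d n))⁻¹ * c n * m * β j := by ring
  simp_rw [e, Finset.sum_sub_distrib, ← Finset.mul_sum, hβ0]
  ring

theorem tendsto_mul_integral_inner_cosCoords_sq (hU : Measurable U)
    (h : (fun c : ℝ => 1 - pathCdf P U (fun _ => 1 - c) - c * m)
      =O[𝓝[>] 0] fun c : ℝ => c ^ (1 + δ)) (hm : 0 < m)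
    (hc : Tendsto c atTop (𝓝[>] 0)) (hd : ∀ᶠ n in atTop, d n = n * c n * m)
    (hdt : Tendsto d atTop atTop)
    (hδ : Tendsto (fun n : ℕ => (n : ℝ) * c n ^ (1 + 2 * δ)) atTop (𝓝 0))
    (k : ℕ) (t : EuclideanSpace ℝ (Fin k)) :
    Tendsto (fun n : ℕ => (n : ℝ) * ∫ ω, inner ℝ (cosCoords k (d n) (c n) (U ω)) t ^ 2 ∂P)
      atTop (𝓝 (∑ i : Fin k, limitWeight (k + 1) (i + 1) * t i ^ 2)) := by
  have hlim := tendsto_finsetSum (Finset.range (k + 1)) fun j _ =>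
    tendsto_finsetSum (Finset.range (k + 1)) fun l _ =>
    (tendsto_mul_integral_weightedExceedance_div hU h hm hc hd hdt hδ (max j l)).const_mul
      ((∑ i : Fin k, t i * cosVec (k + 1) (i + 1) j)
        * (∑ i : Fin k, t i * cosVec (k + 1) (i + 1) l) * ((min j l + 1 : ℕ) : ℝ))
  simp only [mul_one] at hlim
  rw [sum_cosVec_mul_min k t] at hlim
  refine hlim.congr' ?_
  filter_upwards [hdt.eventually_gt_atTop 0, hc.eventually self_mem_nhdsWithin] with n hdn hcn
  simp_rw [inner_cosCoords_sq k hdn (le_of_lt hcn)]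
  have hi (j l : ℕ) (a : ℝ) : Integrable
      (fun ω => a * ((d n)⁻¹ * weightedExceedance (U ω) (max j l) (c n))) P :=
    ((integrable_weightedExceedance hU.aemeasurable _ (c n)).const_mul _).const_mul _
  rw [integral_finsetSum _ fun j _ => integrable_finsetSum _ fun l _ => hi j l _, Finset.mul_sum]
  refine Finset.sum_congr rfl fun j _ => ?_
  rw [integral_finsetSum _ fun l _ => hi j l _, Finset.mul_sum]
  refine Finset.sum_congr rfl fun l _ => ?_
  rw [integral_const_mul, integral_const_mul]
  ring

theorem tendsto_mul_integral_meanContribution (hU : Measurable U)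
    (h : (fun c : ℝ => 1 - pathCdf P U (fun _ => 1 - c) - c * m)
      =O[𝓝[>] 0] fun c : ℝ => c ^ (1 + δ)) (hm : 0 < m)
    (hc : Tendsto c atTop (𝓝[>] 0)) (hd : ∀ᶠ n in atTop, d n = n * c n * m)
    (hdt : Tendsto d atTop atTop)
    (hδ : Tendsto (fun n : ℕ => (n : ℝ) * c n ^ (1 + 2 * δ)) atTop (𝓝 0))
    {k : ℕ} (hk : k ≠ 0) :
    Tendsto (fun n : ℕ => (n : ℝ) * ∫ ω, meanContribution k (d n) (c n) (U ω) ∂P)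
      atTop (𝓝 1) := by
  have hlim := (tendsto_finsetSum (Finset.range k) fun j _ =>
    tendsto_mul_integral_weightedExceedance_div hU h hm hc hd hdt hδ j).const_mul (1 / (k : ℝ))
  have hk' : (k : ℝ) ≠ 0 := by exact_mod_cast hk
  have e : 1 / (k : ℝ) * ∑ j ∈ Finset.range k, (1 : ℝ) = 1 := by simp [hk']
  rw [e] at hlim
  refine hlim.congr fun n => ?_
  simp_rw [meanContribution]
  rw [integral_const_mul, integral_const_mul, integral_finsetSum _ fun j _ =>
    integrable_weightedExceedance hU.aemeasurable j (c n)]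
  simp_rw [← Finset.mul_sum]
  ring

theorem tendsto_mul_integral_meanContribution_sq (hU : Measurable U)
    (h : (fun c : ℝ => 1 - pathCdf P U (fun _ => 1 - c) - c * m)
      =O[𝓝[>] 0] fun c : ℝ => c ^ (1 + δ)) (hm : 0 < m)
    (hc : Tendsto c atTop (𝓝[>] 0)) (hd : ∀ᶠ n in atTop, d n = n * c n * m)
    (hdt : Tendsto d atTop atTop)
    (hδ : Tendsto (fun n : ℕ => (n : ℝ) * c n ^ (1 + 2 * δ)) atTop (𝓝 0))
    {k : ℕ} (hk : k ≠ 0) :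
    Tendsto (fun n : ℕ => (n : ℝ) * ∫ ω, meanContribution k (d n) (c n) (U ω) ^ 2 ∂P)
      atTop (𝓝 0) := by
  -- A nonnegative contribution bounded by `k / d` has square at most `k / d` times itself.
  have hlim := ((tendsto_inv_atTop_zero.comp hdt).mul_const (k : ℝ)).mul
    (tendsto_mul_integral_meanContribution hU h hm hc hd hdt hδ hk)
  simp only [zero_mul] at hlim
  refine squeeze_zero' (Eventually.of_forall fun n => mul_nonneg (Nat.cast_nonneg n)
    (integral_nonneg fun ω => sq_nonneg _)) ?_ hlim
  filter_upwards [hdt.eventually_gt_atTop 0] with n hdn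
  simp only [Function.comp_apply]
  rw [mul_left_comm, ← integral_const_mul ((d n)⁻¹ * (k : ℝ))]
  refine mul_le_mul_of_nonneg_left (integral_mono_of_nonneg
    (ae_of_all _ fun ω => sq_nonneg (meanContribution k (d n) (c n) (U ω))) ?_
    (ae_of_all _ fun ω => ?_)) (Nat.cast_nonneg n)
  · refine Integrable.const_mul (Integrable.of_bound ((measurable_meanContribution k _ _).comp
      hU).aestronglyMeasurable ((d n)⁻¹ * k) (ae_of_all _ fun ω => ?_)) _
    exact abs_meanContribution_le k hdn (c n) (U ω)
  · have h0 : 0 ≤ meanContribution k (d n) (c n) (U ω) := by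
      have := Finset.sum_nonneg fun j (_ : j ∈ Finset.range k) =>
        weightedExceedance_nonneg (U ω) j (c n)
      unfold meanContribution
      positivity
    simp only [sq]
    exact mul_le_mul_of_nonneg_right
      ((le_abs_self _).trans (abs_meanContribution_le k hdn (c n) (U ω))) h0

end Limits

/-! ### Convergence of the test statistic -/

theorem tendstoInDistribution_testStatistic {ΩU Ω Ξ : Type*} [MeasurableSpace ΩU]
    [MeasurableSpace Ω] [MeasurableSpace Ξ] {PU : Measure ΩU} {P : Measure Ω} {Q : Measure Ξ}
    [IsProbabilityMeasure PU] [IsProbabilityMeasure P] [IsProbabilityMeasure Q]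
    {U : ΩU → C(unitInterval, ℝ)} (hU : Measurable U) {m δ : ℝ} (hm : 0 < m)
    (h : (fun c : ℝ => 1 - pathCdf PU U (fun _ => 1 - c) - c * m)
      =O[𝓝[>] 0] fun c : ℝ => c ^ (1 + δ)) (k : ℕ)
    {X : ℕ → Ω → C(unitInterval, ℝ)} (hXU : ∀ i, IdentDistrib (X i) U P PU) (hX : iIndepFun X P)
    {c : ℕ → ℝ} (hc : Tendsto c atTop (𝓝 0))
    (hnc : Tendsto (fun n : ℕ => (n : ℝ) * c n) atTop atTop)
    (hδ : Tendsto (fun n : ℕ => (n : ℝ) * c n ^ (1 + 2 * δ)) atTop (𝓝 0))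
    {ξ : Fin k → Ξ → ℝ} (hξ : ∀ i, HasLaw (ξ i) (gaussianReal 0 1) Q) (hξi : iIndepFun ξ Q) :
    TendstoInDistribution (fun (n : ℕ) ω => testStatistic (fun i => X i ω) (k + 1) n (c n)) atTop
      (fun ω => ∑ i : Fin k, limitWeight (k + 1) (i + 1) * ξ i ω ^ 2) (fun _ => P) Q := by
  -- The maximum with `1` keeps the scale positive for every `n` and is eventually inactive.
  set d : ℕ → ℝ := fun n => max 1 (n * c n * m) with hd_def
  have hdpos (n : ℕ) : 0 < d n := lt_of_lt_of_le one_pos (le_max_left _ _)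
  have hncm : Tendsto (fun n : ℕ => (n : ℝ) * c n * m) atTop atTop := hnc.atTop_mul_const hm
  have hd : ∀ᶠ n in atTop, d n = n * c n * m := by
    filter_upwards [hncm.eventually_ge_atTop 1] with n hn
    exact max_eq_right hn
  have hdt : Tendsto d atTop atTop := tendsto_atTop_mono (fun n => le_max_right _ _) hncm
  -- Divergence of `n * c n` forces `c n` to be eventually positive.
  have hc' : Tendsto c atTop (𝓝[>] 0) := by
    refine tendsto_nhdsWithin_iff.mpr ⟨hc, ?_⟩
    filter_upwards [hnc.eventually_gt_atTop 0] with n hn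
    exact pos_of_mul_pos_right hn (Nat.cast_nonneg n)
  obtain ⟨C, hC⟩ := exists_norm_cosCoords_le k
  have hsd : Tendsto (fun n => (√(d n))⁻¹ * C) atTop (𝓝 0) := by
    simpa using (tendsto_inv_atTop_zero.comp (Real.tendsto_sqrt_atTop.comp hdt)).mul_const C
  have hlw (i : ℕ) : 0 ≤ limitWeight (k + 1) i := by
    rw [limitWeight_eq]; positivity
  set σ : Fin k → ℝ := fun i => √(limitWeight (k + 1) (i + 1)) with hσ
  have hσ2 (i : Fin k) : σ i ^ 2 = limitWeight (k + 1) (i + 1) := Real.sq_sqrt (hlw _)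
  have hclt := tendstoInDistribution_rowSum (Q := Q) hXU hX
    (F := fun n => cosCoords k (d n) (c n)) (fun n => measurable_cosCoords k _ _) hsd
    (fun n u => hC (d n) (c n) u)
    (v := fun t => ∑ i : Fin k, limitWeight (k + 1) (i + 1) * t i ^ 2)
    (fun t => tendsto_mul_integral_inner_cosCoords hU h hm hc' hd hδ k t)
    (fun t => tendsto_mul_integral_inner_cosCoords_sq hU h hm hc' hd hdt hδ k t)
    (G := fun ω => WithLp.toLp 2 fun i => σ i * ξ i ω)
    ((WithLp.measurable_toLp 2 _).comp_aemeasurable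
      (aemeasurable_pi_lambda _ fun i => (hξ i).aemeasurable.const_mul _))
    (fun t => by
      rw [charFun_toLp_mul_gaussian hξ hξi]
      simp_rw [hσ2])
  have hlln := tendstoInMeasure_inv_one (tendstoInMeasure_rowSum hXU hX
    (F := fun n => meanContribution (k + 1) (d n) (c n))
    (fun n => measurable_meanContribution _ _ _)
    (fun n u => abs_meanContribution_le (k + 1) (hdpos n) (c n) u)
    (tendsto_mul_integral_meanContribution hU h hm hc' hd hdt hδ k.succ_ne_zero)
    (tendsto_mul_integral_meanContribution_sq hU h hm hc' hd hdt hδ k.succ_ne_zero))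
  have hg : Continuous fun p : EuclideanSpace ℝ (Fin k) × ℝ => (∑ i : Fin k, p.1 i ^ 2) * p.2 := by
    fun_prop
  have hslutsky := hclt.continuous_comp_prodMk_of_tendstoInMeasure_const hg hlln fun n =>
    (Finset.aemeasurable_fun_sum _ fun i _ =>
      (measurable_meanContribution _ _ _).comp_aemeasurable (hXU i).aemeasurable_fst).inv
  refine hslutsky.congr (fun n => ae_of_all _ fun ω => ?_) (ae_of_all _ fun ω => ?_)
  · exact (testStatistic_eq (fun i => X i ω) k n (c n) (hdpos n)).symm
  · simp only [mul_one, mul_pow, hσ2]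

theorem mainTheorem4
    {ΩU ΩV ΩZ Ω Ξ : Type*} [MeasurableSpace ΩU] [MeasurableSpace ΩV] [MeasurableSpace ΩZ]
    [MeasurableSpace Ω] [MeasurableSpace Ξ]
    (PU : Measure ΩU) (PV : Measure ΩV) (PZ : Measure ΩZ) (P : Measure Ω) (Q : Measure Ξ)
    [IsProbabilityMeasure PU] [IsProbabilityMeasure PV] [IsProbabilityMeasure PZ]
    [IsProbabilityMeasure P] [IsProbabilityMeasure Q]
    (U : ΩU → C(unitInterval, ℝ)) (V : ΩV → C(unitInterval, ℝ)) (Z : ΩZ → C(unitInterval, ℝ))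
    (δ : ℝ) (hδ : 0 < δ)
    (hU : IsCopulaProcess PU U) (hV : IsGPCP PV V PZ Z)
    (hUV : InDeltaNeighborhood PU U PV V δ) :
    ((fun s : ℝ => remainderTerm PU U (generatorConstant PZ Z) s)
      =O[𝓝[<] 0] fun s : ℝ => |s| ^ δ) ∧
    ∀ (k : ℕ), 2 ≤ k →
      -- `X i`, `i ∈ ℕ`, are independent copies of `U`
      ∀ X : ℕ → Ω → C(unitInterval, ℝ),
        (∀ i, IdentDistrib (X i) U P PU) → iIndepFun X P →
      ∀ c : ℕ → ℝ,
        Tendsto c atTop (𝓝 0) →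
        Tendsto (fun n : ℕ => (n : ℝ) * c n) atTop atTop →
        Tendsto (fun n : ℕ => (n : ℝ) * c n ^ (1 + 2 * δ)) atTop (𝓝 0) →
      -- `ξ_1, …, ξ_{k-1}` are independent and standard normal
      ∀ ξ : Fin (k - 1) → Ξ → ℝ,
        (∀ i, HasLaw (ξ i) (gaussianReal 0 1) Q) → iIndepFun ξ Q →
      TendstoInDistribution (fun (n : ℕ) ω => testStatistic (fun i => X i ω) k n (c n)) atTop
        (fun ω => ∑ i : Fin (k - 1), limitWeight k ((i : ℕ) + 1) * ξ i ω ^ 2)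
        (fun _ => P) Q := by
  have h := one_sub_pathCdf_const_isBigO (PU := PU) hV hUV
  refine ⟨remainderTerm_isBigO h, fun k hk X hXU hX c hc hnc hδc ξ hξ hξi => ?_⟩
  obtain ⟨K, rfl⟩ : ∃ K, k = K + 1 := ⟨k - 1, by omega⟩
  exact tendstoInDistribution_testStatistic hU.measurable
    (zero_lt_one.trans_le (one_le_generatorConstant hV.generator)) h K hXU hX hc hnc hδc hξ hξi
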